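/- Let $\mathcal{L}_{\mathsf{PA}} = \{0, 1, +, \cdot, \le\}$ be the language of Peano Arithmetic $\mathsf{PA}$, and let $X$ be a new unary predicate symbol. For a model $\mathcal{M} \models \mathsf{PA}$ with domain $M$, a subset $X \subseteq M$ is called strongly CP-generic if the following holds for every $n \in \mathbb{N}$, every $D \subseteq M^n$ that is definable in $\mathcal{M}$ with parameters from $M$, and every $I \subseteq \{1, \ldots, n\}$: if there is an infinite $B \subseteq D$ such that for all distinct tuples $\langle b_1, \ldots, b_n \rangle, \langle c_1, \ldots, c_n \rangle \in B$ we have $b_i \neq b_j$ for all $i \neq j$ and $\{b_1, \ldots, b_n\} \cap \{c_1, \ldots, c_n\} = \emptyset$, then there is $\langle b_1, \ldots, b_n \rangle \in D$ such that, for all $i$, $b_i \in X$ if and only if $i \in I$. There is a single formula $\phi(x)$ of the language $\mathcal{L}_{\mathsf{PA}} \cup \{X\}$ (without parameters) such that for every countable model $\mathcal{M} \models \mathsf{PA}$ and every subset $A \subseteq M$, there is a strongly CP-generic set $X \subseteq M$ such that $\phi$ defines $A$ in $(\mathcal{M}, X)$, that is, $A = \{a \in M : (\mathcal{M}, X) \models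 \phi(a)\}$. -/

import Mathlib

open FirstOrder

namespace PAModels

open FirstOrder.Language

/-- The function symbols `0, 1, +, ·` of the language of Peano Arithmetic. -/
inductive PAFunc : ℕ → Type
  | zero : PAFunc 0
  | one : PAFunc 0
  | add : PAFunc 2
  | mul : PAFunc 2

/-- The relation symbol `≤` of the language of Peano Arithmetic. -/
inductive PARel : ℕ → Type
  | le : PARel 2

/-- The language `L_PA = {0, 1, +, ·, ≤}` of Peano Arithmetic. -/
def LPA : Language where
  Functions := PAFunc
  Relations := PARel

section Terms

variable {α : Type}

/-- The term `0`. -/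
def tZero : LPA.Term α := Constants.term (L := LPA) PAFunc.zero

/-- The term `1`. -/
def tOne : LPA.Term α := Constants.term (L := LPA) PAFunc.one

/-- The term `s + t`. -/
def tAdd (s t : LPA.Term α) : LPA.Term α := Functions.apply₂ (L := LPA) PAFunc.add s t

/-- The term `s · t`. -/
def tMul (s t : LPA.Term α) : LPA.Term α := Functions.apply₂ (L := LPA) PAFunc.mul s t

/-- The formula `s ≤ t`. -/
def fLe {n : ℕ} (s t : LPA.Term (α ⊕ Fin n)) : LPA.BoundedFormula α n :=
  Relations.boundedFormula₂ (L := LPA) PARel.le s t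

end Terms

/-- The induction axiom for the formula `φ(p, x)`, with parameters `p = (p₀, …, pₖ₋₁)`:
`∀ p, (φ(p, 0) ∧ ∀ x, (φ(p, x) → φ(p, x + 1))) → ∀ x, φ(p, x)`. -/
noncomputable def inductionAxiom {k : ℕ} (φ : LPA.Formula (Fin k ⊕ Fin 1)) : LPA.Sentence :=
  let base : LPA.Formula (Fin k) := φ.subst (Sum.elim Term.var fun _ => tZero)
  let next : LPA.Formula (Fin k ⊕ Fin 1) :=
    φ.subst (Sum.elim (fun i => Term.var (Sum.inl i))
      fun j => tAdd (Term.var (Sum.inr j)) tOne)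
  let step : LPA.Formula (Fin k) := Formula.iAlls (Fin 1) (φ.imp next)
  let concl : LPA.Formula (Fin k) := Formula.iAlls (Fin 1) φ
  Formula.iAlls (Fin k) (Formula.relabel (Sum.inr : Fin k → Empty ⊕ Fin k)
    ((base ⊓ step).imp concl))

/-- The axioms of first-order Peano Arithmetic. -/
inductive IsPAAxiom : LPA.Sentence → Prop
  /-- `∀ x, x + 1 ≠ 0` -/
  | succ_ne_zero : IsPAAxiom (∀' ∼(tAdd &0 tOne =' tZero))
  /-- `∀ x y, x + 1 = y + 1 → x = y` -/
  | succ_inj : IsPAAxiom (∀' ∀' ((tAdd &0 tOne =' tAdd &1 tOne) ⟹ (&0 =' &1)))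
  /-- `∀ x, x + 0 = x` -/
  | add_zero : IsPAAxiom (∀' (tAdd &0 tZero =' &0))
  /-- `∀ x y, x + (y + 1) = (x + y) + 1` -/
  | add_succ : IsPAAxiom (∀' ∀' (tAdd &0 (tAdd &1 tOne) =' tAdd (tAdd &0 &1) tOne))
  /-- `∀ x, x · 0 = 0` -/
  | mul_zero : IsPAAxiom (∀' (tMul &0 tZero =' tZero))
  /-- `∀ x y, x · (y + 1) = x · y + x` -/
  | mul_succ : IsPAAxiom (∀' ∀' (tMul &0 (tAdd &1 tOne) =' tAdd (tMul &0 &1) &0))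
  /-- `∀ x y, x ≤ y ↔ ∃ z, x + z = y` -/
  | le_iff : IsPAAxiom (∀' ∀' ((fLe &0 &1).iff (∃' (tAdd &0 &2 =' &1))))
  /-- The induction scheme, for all formulas of `L_PA`. -/
  | induction {k : ℕ} (φ : LPA.Formula (Fin k ⊕ Fin 1)) : IsPAAxiom (inductionAxiom φ)

/-- Peano Arithmetic, as a first-order theory. -/
def PA : LPA.Theory := {σ | IsPAAxiom σ}

/-- The unary relation symbol `X`. -/
inductive PredRel : ℕ → Type
  | X : PredRel 1

/-- The language `{X}` with a single unary relation symbol. -/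
def LX : Language where
  Functions := fun _ => Empty
  Relations := PredRel

/-- The language `L_PA ∪ {X}`. -/
abbrev LPAX : Language := LPA.sum LX

/-- The `{X}`-structure on `M` in which the symbol `X` is interpreted by the set `X`. -/
abbrev predStructure {M : Type*} (X : Set M) : LX.Structure M where
  funMap := fun f => f.elim
  RelMap := fun r v => match r with
    | PredRel.X => v 0 ∈ X

/-- The formula `φ(x)` of `L_PA ∪ {X}` (without parameters) defines the set `A` in the expansion
`(M, X)`, i.e. `A = {a | (M, X) ⊨ φ(a)}`. -/
def DefinesIn {M : Type*} [LPA.Structure M] (φ : LPAX.Formula (Fin 1)) (X A : Set M) : Prop :=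
  letI : LX.Structure M := predStructure X
  A = {a : M | φ.Realize fun _ => a}

/-- `X ⊆ M` is strongly CP-generic: if `D ⊆ Mⁿ` is definable in `M` (with parameters from `M`),
`I` is a set of indices, and `D` has an infinite subset `B` such that any two different tuples of
`B` have pairwise distinct entries and no entry in common, then some `b ∈ D` satisfies
`bᵢ ∈ X ↔ i ∈ I` for all `i`. -/
def StronglyCPGeneric {M : Type*} [LPA.Structure M] (X : Set M) : Prop :=
  ∀ (n : ℕ) (D : Set (Fin n → M)), (Set.univ : Set M).Definable LPA D →
    ∀ I : Set (Fin n),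
      (∃ B ⊆ D, B.Infinite ∧ ∀ b ∈ B, ∀ c ∈ B, b ≠ c →
        (∀ i j, i ≠ j → b i ≠ b j) ∧ Disjoint (Set.range b) (Set.range c)) →
      ∃ b ∈ D, ∀ i, b i ∈ X ↔ i ∈ I

end PAModels

/-!
A strongly CP-generic set `X` has to meet countably many requirements: one for each pattern `I` and
each definable `D ⊆ Mⁿ` with infinitely many pairwise disjoint tuples. Each can be met by deciding
finitely many points of `X`, so `X` is built from an ideal of conditions meeting countably many
cofinal sets (`Order.idealOfCofinals`). The set `A` has to be coded in such a way that the code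
survives these decisions, and this is done differently in standard and nonstandard models. Whether
`0 ∈ X` tells the decoding formula which of the two codes is in use.

*Nonstandard models.* Let column `a` be the set of the elements `column a k = (a + k)² + a`, for
`k` a standard number. Distinct columns are disjoint. All of column `0` is put into `X`; almost all
of column `a + 1` is put into `X` if `a ∈ A`, and almost none of it if `a ∉ A`. The requirements can
still be met after finitely many columns and finitely many further points have been decided
(`IsLarge.exists_avoiding_columns`): the set of all `c` such that some tuple of `D` avoids the
finitely many points and the first `c` places of the finitely many columns is definable and contains
every standard number, so by overspill it contains a nonstandard one. Conversely the decoding works,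
because `X`, being generic, contains no infinite definable set; so `k` is standard if and only if
`i * i = column 0 i ∈ X` for all `i ≤ k` (`StronglyCPGeneric.inCut_iff`). Thus the standard cut is
definable from `X`, and `a ∈ A` says that `column (a + 1) k ∈ X` for almost all standard `k`.

*The standard model.* Here `X` is built by finite end extensions, and `a ∈ A` is coded by the parity
of the start of the first run of `a + 1` consecutive elements of `X`. To meet a requirement about
`n`-tuples, one first provides runs of all lengths up to `n + 1`; the at most `n` new points
needed for the requirement are then chosen beyond a gap, and too few to make a first run of any
other length (`RunCond.exists_ge_tuple`).

Models of `PA` are handled through the discretely ordered semiring structure which they carry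
(`exists_isDiscreteModel`).
-/

namespace PAModels

open FirstOrder.Language

/-- The arithmetic operations of `M` agree with the `L_PA`-structure of `M`. -/
class Compatible (M : Type*) [LPA.Structure M] [Zero M] [One M] [Add M] [Mul M] [LE M] : Prop where
  funMap_zero (v : Fin 0 → M) : Structure.funMap (L := LPA) PAFunc.zero v = 0
  funMap_one (v : Fin 0 → M) : Structure.funMap (L := LPA) PAFunc.one v = 1
  funMap_add (v : Fin 2 → M) : Structure.funMap (L := LPA) PAFunc.add v = v 0 + v 1
  funMap_mul (v : Fin 2 → M) : Structure.funMap (L := LPA) PAFunc.mul v = v 0 * v 1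
  relMap_le (v : Fin 2 → M) : Structure.RelMap (L := LPA) PARel.le v ↔ v 0 ≤ v 1

/-- `M` is the nonnegative part of a discretely ordered commutative ring, with operations
compatible with its `L_PA`-structure. -/
class IsDiscreteModel (M : Type*) [LPA.Structure M] [CommSemiring M] [LinearOrder M] : Prop
    extends IsStrictOrderedRing M, CanonicallyOrderedAdd M, Compatible M where
  eq_zero_or_one_le (x : M) : x = 0 ∨ 1 ≤ x

/-! ### Interpreting `L_PA` by ring operations -/

section Realize

variable {M : Type*} [LPA.Structure M] [Zero M] [One M] [Add M] [Mul M] [LE M] [Compatible M]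
  {α : Type} {v : α → M}

@[simp] theorem realize_tZero : (tZero : LPA.Term α).realize v = 0 :=
  Compatible.funMap_zero _

@[simp] theorem realize_tOne : (tOne : LPA.Term α).realize v = 1 :=
  Compatible.funMap_one _

@[simp] theorem realize_tAdd {s t : LPA.Term α} :
    (tAdd s t).realize v = s.realize v + t.realize v :=
  Compatible.funMap_add _

@[simp] theorem realize_tMul {s t : LPA.Term α} :
    (tMul s t).realize v = s.realize v * t.realize v :=
  Compatible.funMap_mul _

@[simp] theorem realize_fLe {n : ℕ} {xs : Fin n → M} {s t : LPA.Term (α ⊕ Fin n)} :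
    (fLe s t).Realize v xs ↔
      s.realize (Sum.elim v xs) ≤ t.realize (Sum.elim v xs) :=
  Compatible.relMap_le _

theorem realize_inductionAxiom {k : ℕ} (φ : LPA.Formula (Fin k ⊕ Fin 1)) :
    M ⊨ inductionAxiom φ ↔ ∀ p : Fin k → M, φ.Realize (Sum.elim p fun _ => 0) →
      (∀ x, φ.Realize (Sum.elim p fun _ => x) → φ.Realize (Sum.elim p fun _ => x + 1)) →
      ∀ x, φ.Realize (Sum.elim p fun _ => x) := by
  have e2 (p : Fin k → M) (x : M) : (fun a => Term.realize (Sum.elim p (fun _ => x))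
      (Sum.elim (fun i => (Term.var (Sum.inl i) : LPA.Term (Fin k ⊕ Fin 1)))
        (fun j => tAdd (Term.var (Sum.inr j)) tOne) a)) = Sum.elim p fun _ => x + 1 := by
    funext a; rcases a with a | a <;> simp
  have e3 (p : Fin k → M) : (fun a => Term.realize p
      (Sum.elim (Term.var : Fin k → LPA.Term (Fin k)) (fun _ : Fin 1 => tZero) a)) =
        Sum.elim p fun _ => 0 := by
    funext a; rcases a with a | a <;> simp
  have e4 (P : (Fin 1 → M) → Prop) : (∀ i, P i) ↔ ∀ x, P fun _ => x :=
    ⟨fun h x => h _, fun h i => by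
      have : i = fun _ => i 0 := by funext j; rw [Subsingleton.elim j 0]
      rw [this]; exact h _⟩
  simp only [inductionAxiom, Sentence.Realize, Formula.realize_iAlls, Formula.realize_relabel]
  refine forall_congr' fun p => ?_
  simp only [Formula.Realize, BoundedFormula.realize_imp, BoundedFormula.realize_inf,
    BoundedFormula.realize_subst]
  erw [BoundedFormula.realize_iAlls, BoundedFormula.realize_iAlls]
  -- The relabelled variables `Fin k → Empty ⊕ Fin k` are evaluated at `p` by definition.
  change ((BoundedFormula.Realize φ (fun a => Term.realize p
      (Sum.elim (Term.var : Fin k → LPA.Term (Fin k)) (fun _ : Fin 1 => tZero) a)) default ∧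
    ∀ i : Fin 1 → M, BoundedFormula.Realize φ (Sum.elim p i) default →
      BoundedFormula.Realize (φ.subst _) (Sum.elim p i) default) →
    ∀ i : Fin 1 → M, BoundedFormula.Realize φ (Sum.elim p i) default) ↔ _
  simp only [BoundedFormula.realize_subst, e3, e4, e2, and_imp]

end Realize

/-! ### Induction and definability -/

section Induction

variable {M : Type*} [LPA.Structure M] [Zero M] [One M] [Add M] [Mul M] [LE M] [Compatible M]

/-- Induction for sets definable with parameters. -/
theorem definable_induction (hM : M ⊨ PA) {S : Set M} (hS : (Set.univ : Set M).Definable₁ LPA S)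
    (h0 : (0 : M) ∈ S) (h1 : ∀ x ∈ S, x + 1 ∈ S) (x : M) : x ∈ S := by
  -- Only finitely many parameters occur, as required by the form of the induction axioms.
  obtain ⟨A, -, hA⟩ := Set.definable_iff_finitely_definable.1 hS
  obtain ⟨φ, hφ⟩ := Set.definable_iff_exists_formula_sum.1 hA
  let e := A.equivFin
  have key (x : M) : x ∈ S ↔
      (φ.relabel (Sum.map e id)).Realize
        (Sum.elim (fun i => ((e.symm i : A) : M)) fun _ : Fin 1 => x) := by
    have := congrArg (fun T => (fun _ : Fin 1 => x) ∈ T) hφ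
    simp only [Set.mem_ofPred_eq, eq_iff_iff] at this
    rw [this, Formula.realize_relabel]
    refine iff_of_eq (congrArg _ ?_)
    funext a
    rcases a with a | a <;> simp
  have := (realize_inductionAxiom (φ.relabel (Sum.map e id))).1
    (hM.realize_of_mem _ (IsPAAxiom.induction _)) (fun i => ((e.symm i : A) : M))
  simp only [← key] at this
  exact this h0 h1 x

open Set in
@[fun_prop]
theorem definableFun_add {α : Type*} {A : Set M} {f g : (α → M) → M} (hf : A.DefinableFun LPA f)
    (hg : A.DefinableFun LPA g) : A.DefinableFun LPA fun v => f v + g v := by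
  have h : A.DefinableFun LPA (Structure.funMap (L := LPA) (M := M) PAFunc.add) :=
    (DefinableFun.fun_symbol _).of_empty
  have hF : A.DefinableMap LPA (fun v => ![f v, g v]) := by
    simp [DefinableMap, *]
  simpa [Compatible.funMap_add] using DefinableFun.comp hF h

open Set in
@[fun_prop]
theorem definableFun_mul {α : Type*} {A : Set M} {f g : (α → M) → M} (hf : A.DefinableFun LPA f)
    (hg : A.DefinableFun LPA g) : A.DefinableFun LPA fun v => f v * g v := by
  have h : A.DefinableFun LPA (Structure.funMap (L := LPA) (M := M) PAFunc.mul) :=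
    (DefinableFun.fun_symbol _).of_empty
  have hF : A.DefinableMap LPA (fun v => ![f v, g v]) := by
    simp [DefinableMap, *]
  simpa [Compatible.funMap_mul] using DefinableFun.comp hF h

open Set in
theorem definable_le {α : Type*} {A : Set M} {f g : (α → M) → M} (hf : A.DefinableFun LPA f)
    (hg : A.DefinableFun LPA g) : A.Definable LPA {v | f v ≤ g v} := by
  have hF : A.DefinableMap LPA (fun v => ![f v, g v]) := by
    simp [DefinableMap, *]
  have h : A.Definable LPA {v : Fin 2 → M | v 0 ≤ v 1} := by
    refine Definable.mono (empty_definable_iff.2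
      ⟨(fLe (Term.var (Sum.inl 0)) (Term.var (Sum.inl 1)) : LPA.BoundedFormula (Fin 2) 0), ?_⟩)
      (empty_subset _)
    ext v
    simp [Formula.Realize]
  exact h.preimage_map hF

/-- Parameters are definable: stated without side condition for the use of `fun_prop`. -/
@[fun_prop]
theorem definableFun_param {M : Type*} [LPA.Structure M] {α : Type*} (a : M) :
    (Set.univ : Set M).DefinableFun LPA (fun _ : α → M => a) :=
  definableFun_const _ _ (Set.mem_univ a)

end Induction

/-! ### Models of `PA` as discretely ordered semirings -/

section Arithmetic

variable {M : Type*} [LPA.Structure M]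

/-- The zero of an `L_PA`-structure. -/
abbrev structZero : Zero M := ⟨Structure.funMap (L := LPA) PAFunc.zero ![]⟩
/-- The one of an `L_PA`-structure. -/
abbrev structOne : One M := ⟨Structure.funMap (L := LPA) PAFunc.one ![]⟩
/-- The addition of an `L_PA`-structure. -/
abbrev structAdd : Add M := ⟨fun x y => Structure.funMap (L := LPA) PAFunc.add ![x, y]⟩
/-- The multiplication of an `L_PA`-structure. -/
abbrev structMul : Mul M := ⟨fun x y => Structure.funMap (L := LPA) PAFunc.mul ![x, y]⟩
/-- The order of an `L_PA`-structure. -/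
abbrev structLE : LE M := ⟨fun x y => Structure.RelMap (L := LPA) PARel.le ![x, y]⟩

attribute [local instance] structZero structOne structAdd structMul structLE

theorem compatible_struct : Compatible M where
  funMap_zero v := congrArg _ (Subsingleton.elim _ _)
  funMap_one v := congrArg _ (Subsingleton.elim _ _)
  funMap_add v := congrArg _ (by ext i; fin_cases i <;> rfl)
  funMap_mul v := congrArg _ (by ext i; fin_cases i <;> rfl)
  relMap_le v := iff_of_eq (congrArg _ (by ext i; fin_cases i <;> rfl))

attribute [local instance] compatible_struct

/-- The axioms of `PA`, in terms of the arithmetic operations. -/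
structure PAFacts (M : Type*) [LPA.Structure M] : Prop where
  succ_ne_zero (x : M) : x + 1 ≠ 0
  succ_inj (x y : M) : x + 1 = y + 1 → x = y
  add_zero (x : M) : x + 0 = x
  add_succ (x y : M) : x + (y + 1) = x + y + 1
  mul_zero (x : M) : x * 0 = 0
  mul_succ (x y : M) : x * (y + 1) = x * y + x
  le_iff (x y : M) : x ≤ y ↔ ∃ z, x + z = y
  ind {S : Set M} (hS : (Set.univ : Set M).Definable₁ LPA S) (h0 : (0 : M) ∈ S)
    (h1 : ∀ x ∈ S, x + 1 ∈ S) (x : M) : x ∈ S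

theorem paFacts (hM : M ⊨ PA) : PAFacts M where
  succ_ne_zero := by
    simpa [Sentence.Realize, Formula.Realize, Fin.snoc] using
      hM.realize_of_mem _ IsPAAxiom.succ_ne_zero
  succ_inj := by
    simpa [Sentence.Realize, Formula.Realize, Fin.snoc] using
      hM.realize_of_mem _ IsPAAxiom.succ_inj
  add_zero := by
    simpa [Sentence.Realize, Formula.Realize, Fin.snoc] using
      hM.realize_of_mem _ IsPAAxiom.add_zero
  add_succ := by
    simpa [Sentence.Realize, Formula.Realize, Fin.snoc] using
      hM.realize_of_mem _ IsPAAxiom.add_succ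
  mul_zero := by
    simpa [Sentence.Realize, Formula.Realize, Fin.snoc] using
      hM.realize_of_mem _ IsPAAxiom.mul_zero
  mul_succ := by
    simpa [Sentence.Realize, Formula.Realize, Fin.snoc] using
      hM.realize_of_mem _ IsPAAxiom.mul_succ
  le_iff := by
    simpa [Sentence.Realize, Formula.Realize, Fin.snoc] using
      hM.realize_of_mem _ IsPAAxiom.le_iff
  ind := definable_induction hM

namespace PAFacts

variable (h : PAFacts M)
include h

/-- Induction for an equation between definable functions. -/
theorem eq_ind {f g : M → M}
    (hf : (Set.univ : Set M).DefinableFun LPA fun v : Fin 1 → M => f (v 0))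
    (hg : (Set.univ : Set M).DefinableFun LPA fun v : Fin 1 → M => g (v 0))
    (h0 : f 0 = g 0) (h1 : ∀ x, f x = g x → f (x + 1) = g (x + 1)) (x : M) : f x = g x :=
  h.ind (S := {x | f x = g x}) (Set.DefinableFun.ofPred_eq hf hg) h0 h1 x

theorem zero_add (x : M) : 0 + x = x :=
  h.eq_ind (f := fun x => 0 + x) (g := fun x => x) (by fun_prop) (by fun_prop)
    (h.add_zero 0) (fun x hx => by rw [h.add_succ, hx]) x

theorem succ_add (x y : M) : x + 1 + y = x + y + 1 :=
  h.eq_ind (f := fun y => x + 1 + y) (g := fun y => x + y + 1) (by fun_prop) (by fun_prop)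
    (by rw [h.add_zero, h.add_zero]) (fun y hy => by rw [h.add_succ, h.add_succ, hy]) y

theorem add_comm (x y : M) : x + y = y + x :=
  h.eq_ind (f := fun y => x + y) (g := fun y => y + x) (by fun_prop) (by fun_prop)
    (by rw [h.add_zero, h.zero_add]) (fun y hy => by rw [h.add_succ, h.succ_add, hy]) y

theorem add_assoc (x y z : M) : x + y + z = x + (y + z) :=
  h.eq_ind (f := fun z => x + y + z) (g := fun z => x + (y + z)) (by fun_prop) (by fun_prop)
    (by rw [h.add_zero, h.add_zero]) (fun z hz => by rw [h.add_succ, h.add_succ, h.add_succ, hz]) z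

theorem add_left_comm (x y z : M) : x + (y + z) = y + (x + z) := by
  rw [← h.add_assoc, h.add_comm x y, h.add_assoc]

theorem zero_mul (x : M) : 0 * x = 0 :=
  h.eq_ind (f := fun x => 0 * x) (g := fun _ => 0) (by fun_prop) (by fun_prop)
    (h.mul_zero 0) (fun x hx => by rw [h.mul_succ, hx, h.add_zero]) x

theorem succ_mul (x y : M) : (x + 1) * y = x * y + y :=
  h.eq_ind (f := fun y => (x + 1) * y) (g := fun y => x * y + y) (by fun_prop) (by fun_prop)
    (by rw [h.mul_zero, h.mul_zero, h.add_zero]) (fun y hy => by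
      rw [h.mul_succ, h.mul_succ, hy, h.add_assoc, h.add_assoc]
      rw [h.add_left_comm y x]) y

theorem mul_comm (x y : M) : x * y = y * x :=
  h.eq_ind (f := fun y => x * y) (g := fun y => y * x) (by fun_prop) (by fun_prop)
    (by rw [h.mul_zero, h.zero_mul]) (fun y hy => by rw [h.mul_succ, h.succ_mul, hy]) y

theorem mul_add (x y z : M) : x * (y + z) = x * y + x * z :=
  h.eq_ind (f := fun z => x * (y + z)) (g := fun z => x * y + x * z) (by fun_prop) (by fun_prop)
    (by rw [h.mul_zero, h.add_zero, h.add_zero])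
    (fun z hz => by rw [h.add_succ, h.mul_succ, h.mul_succ, hz, h.add_assoc]) z

theorem mul_assoc (x y z : M) : x * y * z = x * (y * z) :=
  h.eq_ind (f := fun z => x * y * z) (g := fun z => x * (y * z)) (by fun_prop) (by fun_prop)
    (by rw [h.mul_zero, h.mul_zero, h.mul_zero])
    (fun z hz => by rw [h.mul_succ, h.mul_succ, h.mul_add, hz]) z

theorem one_mul (x : M) : 1 * x = x := by
  rw [← h.zero_add 1, h.succ_mul, h.zero_mul, h.zero_add]

theorem add_right_cancel {x y z : M} (hxy : x + z = y + z) : x = y := by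
  by_contra hne
  refine h.ind (S := {z | x + z = y + z}ᶜ)
    (Set.DefinableFun.ofPred_eq (by fun_prop) (by fun_prop)).compl ?_ (fun z hz hz' => ?_) z hxy
  · simpa [h.add_zero] using hne
  · refine hz (h.succ_inj _ _ ?_)
    rw [← h.add_succ, ← h.add_succ]
    exact hz'

theorem eq_zero_or_one_le (x : M) : x = 0 ∨ 1 ≤ x := by
  refine h.ind (S := {x | x = 0} ∪ {x | 1 ≤ x}) (Set.Definable.union
    (Set.DefinableFun.ofPred_eq (by fun_prop) (by fun_prop))
    (definable_le (by fun_prop) (by fun_prop))) (Or.inl rfl) (fun x _ => Or.inr ?_) x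
  exact (h.le_iff _ _).2 ⟨x, h.add_comm _ _⟩

theorem eq_zero_of_add_eq_zero {x y : M} (hxy : x + y = 0) : y = 0 := by
  rcases h.eq_zero_or_one_le y with hy | hy
  · exact hy
  · obtain ⟨z, rfl⟩ := (h.le_iff _ _).1 hy
    rw [h.add_comm 1 z, h.add_succ] at hxy
    exact (h.succ_ne_zero _ hxy).elim

theorem le_antisymm {x y : M} (hxy : x ≤ y) (hyx : y ≤ x) : x = y := by
  obtain ⟨z, rfl⟩ := (h.le_iff _ _).1 hxy
  obtain ⟨w, hw⟩ := (h.le_iff _ _).1 hyx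
  have h0 : w + z = 0 := h.add_right_cancel (z := x) (by
    rw [h.zero_add, h.add_comm, h.add_comm w, ← h.add_assoc, hw])
  rw [h.eq_zero_of_add_eq_zero h0, h.add_zero]

theorem le_total (x y : M) : x ≤ y ∨ y ≤ x := by
  refine h.ind (S := {y | x ≤ y} ∪ {y | y ≤ x}) (Set.Definable.union
    (definable_le (by fun_prop) (by fun_prop)) (definable_le (by fun_prop) (by fun_prop)))
    (Or.inr ((h.le_iff _ _).2 ⟨x, h.zero_add x⟩)) (fun y hy => ?_) y
  have up {y : M} (hy : x ≤ y) : x ≤ y + 1 := by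
    obtain ⟨z, rfl⟩ := (h.le_iff _ _).1 hy
    exact (h.le_iff _ _).2 ⟨z + 1, by rw [h.add_succ]⟩
  rcases hy with hy | hy
  · exact Or.inl (up hy)
  · obtain ⟨z, rfl⟩ := (h.le_iff _ _).1 hy
    rcases h.eq_zero_or_one_le z with rfl | hz
    · exact Or.inl ((h.le_iff _ _).2 ⟨1, by rw [h.add_zero]⟩)
    · obtain ⟨w, rfl⟩ := (h.le_iff _ _).1 hz
      exact Or.inr ((h.le_iff _ _).2 ⟨w, h.add_assoc _ _ _⟩)

/-- The commutative semiring underlying a model of `PA`. -/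
abbrev commSemiring : CommSemiring M where
  add_assoc := h.add_assoc
  zero_add := h.zero_add
  add_zero := h.add_zero
  add_comm := h.add_comm
  left_distrib := h.mul_add
  right_distrib x y z := by rw [h.mul_comm, h.mul_add, h.mul_comm z, h.mul_comm z]
  zero_mul := h.zero_mul
  mul_zero := h.mul_zero
  mul_assoc := h.mul_assoc
  one_mul := h.one_mul
  mul_one x := by rw [h.mul_comm, h.one_mul]
  mul_comm := h.mul_comm
  nsmul := nsmulRec

open Classical in
/-- The linear order underlying a model of `PA`. -/
noncomputable abbrev linearOrder : LinearOrder M where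
  le_refl x := (h.le_iff _ _).2 ⟨0, h.add_zero x⟩
  le_trans x y z hxy hyz := by
    obtain ⟨u, rfl⟩ := (h.le_iff _ _).1 hxy
    obtain ⟨v, rfl⟩ := (h.le_iff _ _).1 hyz
    exact (h.le_iff _ _).2 ⟨u + v, (h.add_assoc _ _ _).symm⟩
  le_antisymm _ _ := h.le_antisymm
  le_total := h.le_total
  toDecidableLE := Classical.decRel _

end PAFacts

/-- A model of `PA` is the nonnegative part of a discretely ordered ring. -/
theorem exists_isDiscreteModel (hM : M ⊨ PA) :
    ∃ (_ : CommSemiring M) (_ : LinearOrder M), IsDiscreteModel M := by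
  have h := paFacts hM
  let i1 : CommSemiring M := h.commSemiring
  let i2 : LinearOrder M := h.linearOrder
  have i3 : CanonicallyOrderedAdd M :=
    { exists_add_of_le := fun hab => by
        obtain ⟨c, hc⟩ := (h.le_iff _ _).1 hab
        exact ⟨c, hc.symm⟩
      le_add_self := fun a b => (h.le_iff _ _).2 ⟨b, h.add_comm _ _⟩
      le_self_add := fun a b => (h.le_iff _ _).2 ⟨b, rfl⟩ }
  have i4 : IsOrderedCancelAddMonoid M :=
    { add_le_add_left := fun a b hab c => by
        obtain ⟨d, rfl⟩ := (h.le_iff _ _).1 hab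
        exact (h.le_iff _ _).2 ⟨d, by
          rw [h.add_assoc, h.add_assoc, h.add_comm c]⟩
      le_of_add_le_add_left := fun a b c hbc => by
        obtain ⟨d, hd⟩ := (h.le_iff _ _).1 hbc
        refine (h.le_iff _ _).2 ⟨d, h.add_right_cancel (z := a) ?_⟩
        rw [h.add_comm, ← h.add_assoc, hd, h.add_comm] }
  have mul_lt (a : M) (ha : 0 < a) (b c : M) (hbc : b < c) : a * b < a * c := by
    obtain ⟨d, rfl⟩ := (h.le_iff _ _).1 hbc.le
    refine lt_of_le_of_ne ((h.le_iff _ _).2 ⟨a * d, (h.mul_add _ _ _).symm⟩) fun he => ?_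
    have h0 : a * d = 0 := h.add_right_cancel (z := a * b) (by
      rw [h.zero_add, h.add_comm, ← h.mul_add, ← he])
    obtain ⟨a, rfl⟩ := (h.le_iff _ _).1 ((h.eq_zero_or_one_le a).resolve_left ha.ne')
    have hd : d ≠ 0 := by
      rintro rfl
      exact hbc.ne (h.add_zero b).symm
    rw [h.add_comm 1 a, h.succ_mul] at h0
    exact hd (h.eq_zero_of_add_eq_zero h0)
  exact ⟨i1, i2,
    { i3, i4, compatible_struct (M := M) with
      eq_zero_or_one_le := h.eq_zero_or_one_le
      zero_le_one := (h.le_iff _ _).2 ⟨1, h.zero_add 1⟩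
      exists_pair_ne := ⟨0, 1, fun h01 => h.succ_ne_zero 0 (by rw [h.zero_add, ← h01])⟩
      mul_lt_mul_of_pos_left := fun a ha b c hbc => mul_lt a ha b c hbc
      mul_lt_mul_of_pos_right := fun a ha b c hbc => by
        change b * a < c * a
        rw [h.mul_comm b, h.mul_comm c]
        exact mul_lt a ha b c hbc }⟩

end Arithmetic
/-! ### Generic sets with prescribed behaviour on columns -/

section Columns

/-- Conditions for the construction in the nonstandard case. The pair `p` decides `p.1 ⊆ X` and
`p.2 ∩ X = ∅`. The decided points lie in finitely many columns `E i`, up to a finite set, and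
almost no decision on the column `E i` goes against the value prescribed by `i ∈ A`. -/
abbrev ColumnCond {M ι : Type*} (E : ι → Set M) (A : Set ι) : Type _ :=
  {p : Set M × Set M // Disjoint p.1 p.2 ∧
    (∃ S : Finset ι, ((p.1 ∪ p.2) \ ⋃ i ∈ S, E i).Finite) ∧
    (∀ i ∈ A, (E i ∩ p.2).Finite) ∧ ∀ i ∉ A, (E i ∩ p.1).Finite}

variable {M ι κ : Type*} {E : ι → Set M} {A : Set ι}

/-- Every condition can be extended so as to decide all points of a given column. -/
theorem ColumnCond.exists_ge_column (hE : ∀ i j, i ≠ j → (E i ∩ E j).Finite) (i : ι)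
    (p : ColumnCond E A) : ∃ q ≥ p, E i ⊆ q.1.1 ∪ q.1.2 := by
  classical
  obtain ⟨⟨P, N⟩, hd, ⟨S, hS⟩, hA, hA'⟩ := p
  have hS' {P' N' : Set M} (h : P' ∪ N' ⊆ P ∪ N ∪ E i) :
      ((P' ∪ N') \ ⋃ j ∈ insert i S, E j).Finite := by
    refine hS.subset fun x hx => ?_
    have := h hx.1
    simp only [Finset.mem_insert, Set.iUnion_iUnion_eq_or_left, Set.mem_sdiff, Set.mem_union,
      not_or] at hx this ⊢
    tauto
  by_cases hi : i ∈ A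
  · refine ⟨⟨(P ∪ (E i \ N), N), ?_, ⟨insert i S, hS' ?_⟩, hA, fun j hj => ?_⟩, ?_, ?_⟩
    · exact Set.disjoint_union_left.2 ⟨hd, Set.disjoint_sdiff_left⟩
    · rintro x ((hx | hx) | hx) <;> simp_all
    · refine ((hA' j hj).union (hE j i ?_)).subset ?_
      · rintro rfl; exact hj hi
      · rintro x ⟨hx, hx' | hx'⟩
        · exact Or.inl ⟨hx, hx'⟩
        · exact Or.inr ⟨hx, hx'.1⟩
    · exact ⟨Set.subset_union_left, subset_rfl⟩
    · intro x hx
      by_cases hN : x ∈ N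
      · exact Or.inr hN
      · exact Or.inl (Or.inr ⟨hx, hN⟩)
  · refine ⟨⟨(P, N ∪ (E i \ P)), ?_, ⟨insert i S, hS' ?_⟩, fun j hj => ?_, hA'⟩, ?_, ?_⟩
    · exact Set.disjoint_union_right.2 ⟨hd, Set.disjoint_sdiff_right⟩
    · rintro x (hx | (hx | hx)) <;> simp_all
    · refine ((hA j hj).union (hE j i ?_)).subset ?_
      · rintro rfl; exact hi hj
      · rintro x ⟨hx, hx' | hx'⟩
        · exact Or.inl ⟨hx, hx'⟩
        · exact Or.inr ⟨hx, hx'.1⟩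
    · exact ⟨subset_rfl, Set.subset_union_left⟩
    · intro x hx
      by_cases hP : x ∈ P
      · exact Or.inl hP
      · exact Or.inr (Or.inr ⟨hx, hP⟩)

/-- Every condition can be extended so as to realize a pattern on some tuple of `D`, if `D` has
tuples avoiding any finitely many points and columns. -/
theorem ColumnCond.exists_ge_tuple {n : ℕ} {D : Set (Fin n → M)} (I : Set (Fin n))
    (hD : ∀ (S : Finset ι) (F : Set M), F.Finite →
      ∃ b ∈ D, b.Injective ∧ ∀ i, b i ∉ F ∧ ∀ s ∈ S, b i ∉ E s)
    (p : ColumnCond E A) : ∃ q ≥ p, ∃ b ∈ D, b '' I ⊆ q.1.1 ∧ b '' Iᶜ ⊆ q.1.2 := by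
  obtain ⟨⟨P, N⟩, hd, ⟨S, hS⟩, hA, hA'⟩ := p
  obtain ⟨b, hb, hinj, hav⟩ := hD S _ hS
  have hnew (i : Fin n) : b i ∉ P ∪ N := fun h =>
    (hav i).1 ⟨h, by simpa using (hav i).2⟩
  refine ⟨⟨(P ∪ b '' I, N ∪ b '' Iᶜ), ?_, ⟨S, ?_⟩, fun j hj => ?_, fun j hj => ?_⟩, ?_, b, hb,
    Set.subset_union_right, Set.subset_union_right⟩
  · simp only [Set.disjoint_union_left, Set.disjoint_union_right]
    refine ⟨⟨hd, ?_⟩, ?_, ?_⟩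
    · rw [Set.disjoint_left]
      rintro _ ⟨i, -, rfl⟩ h
      exact hnew i (Or.inr h)
    · rw [Set.disjoint_right]
      rintro _ ⟨i, -, rfl⟩ h
      exact hnew i (Or.inl h)
    · exact (Set.disjoint_image_iff hinj).2 disjoint_compl_right
  · refine (hS.union (Set.finite_range b)).subset ?_
    rintro x ⟨(hx | ⟨i, -, rfl⟩) | (hx | ⟨i, -, rfl⟩), hx'⟩
    · exact Or.inl ⟨Or.inl hx, hx'⟩
    · exact Or.inr ⟨i, rfl⟩
    · exact Or.inl ⟨Or.inr hx, hx'⟩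
    · exact Or.inr ⟨i, rfl⟩
  · refine ((hA j hj).union (Set.finite_range b)).subset ?_
    rintro x ⟨hx, hx' | ⟨i, -, rfl⟩⟩
    · exact Or.inl ⟨hx, hx'⟩
    · exact Or.inr ⟨i, rfl⟩
  · refine ((hA' j hj).union (Set.finite_range b)).subset ?_
    rintro x ⟨hx, hx' | ⟨i, -, rfl⟩⟩
    · exact Or.inl ⟨hx, hx'⟩
    · exact Or.inr ⟨i, rfl⟩
  · exact ⟨Set.subset_union_left, Set.subset_union_left⟩

/-- For almost disjoint columns `E i`, there is a set `X` which contains almost all of `E i` for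
`i ∈ A` and almost nothing of it for `i ∉ A`, contains the whole column `E i₀`, and realizes
countably many prescribed patterns. -/
theorem exists_generic_of_columns [Countable ι] [Countable κ]
    (hE : ∀ i j, i ≠ j → (E i ∩ E j).Finite) {i₀ : ι} (hi₀ : i₀ ∈ A)
    {n : κ → ℕ} {D : ∀ k, Set (Fin (n k) → M)} (I : ∀ k, Set (Fin (n k)))
    (hD : ∀ (k : κ) (S : Finset ι) (F : Set M), F.Finite →
      ∃ b ∈ D k, b.Injective ∧ ∀ i, b i ∉ F ∧ ∀ s ∈ S, b i ∉ E s) :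
    ∃ X : Set M, E i₀ ⊆ X ∧ (∀ i ∈ A, (E i \ X).Finite) ∧ (∀ i ∉ A, (E i ∩ X).Finite) ∧
      ∀ k, ∃ b ∈ D k, ∀ j, b j ∈ X ↔ j ∈ I k := by
  let p₀ : ColumnCond E A := ⟨(E i₀, ∅), by simp, ⟨{i₀}, by simp⟩, by simp, fun i hi =>
    hE i i₀ (by rintro rfl; exact hi hi₀)⟩
  let 𝒟 : ι ⊕ κ → Order.Cofinal (ColumnCond E A) := Sum.elim
    (fun i => ⟨{q | E i ⊆ q.1.1 ∪ q.1.2}, fun p => by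
      obtain ⟨q, hq, h⟩ := p.exists_ge_column hE i; exact ⟨q, h, hq⟩⟩)
    (fun k => ⟨{q | ∃ b ∈ D k, b '' I k ⊆ q.1.1 ∧ b '' (I k)ᶜ ⊆ q.1.2}, fun p => by
      obtain ⟨q, hq, h⟩ := p.exists_ge_tuple (I k) (hD k); exact ⟨q, h, hq⟩⟩)
  let _ : Encodable (ι ⊕ κ) := Encodable.ofCountable _
  let G := Order.idealOfCofinals p₀ 𝒟
  let X : Set M := {x | ∃ q ∈ G, x ∈ q.1.1}
  have hpos {q : ColumnCond E A} (hq : q ∈ G) : q.1.1 ⊆ X := fun x hx => ⟨q, hq, hx⟩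
  have hneg {q : ColumnCond E A} (hq : q ∈ G) {x : M} (hx : x ∈ q.1.2) : x ∉ X := by
    rintro ⟨r, hr, hxr⟩
    obtain ⟨s, -, hqs, hrs⟩ := G.directed q hq r hr
    exact Set.disjoint_left.1 s.2.1 (hrs.1 hxr) (hqs.2 hx)
  refine ⟨X, hpos (Order.mem_idealOfCofinals p₀ 𝒟), fun i hi => ?_, fun i hi => ?_, fun k => ?_⟩
  · obtain ⟨q, hq, hqG⟩ := Order.cofinal_meets_idealOfCofinals p₀ 𝒟 (Sum.inl i)
    refine (q.2.2.2.1 i hi).subset fun x hx => ⟨hx.1, (hq hx.1).resolve_left fun h => ?_⟩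
    exact hx.2 (hpos hqG h)
  · obtain ⟨q, hq, hqG⟩ := Order.cofinal_meets_idealOfCofinals p₀ 𝒟 (Sum.inl i)
    refine (q.2.2.2.2 i hi).subset fun x hx => ⟨hx.1, (hq hx.1).resolve_right fun h => ?_⟩
    exact hneg hqG h hx.2
  · obtain ⟨q, ⟨b, hb, h1, h2⟩, hqG⟩ := Order.cofinal_meets_idealOfCofinals p₀ 𝒟 (Sum.inr k)
    refine ⟨b, hb, fun j => ⟨fun hj => ?_, fun hj => hpos hqG (h1 ⟨j, hj, rfl⟩)⟩⟩
    by_contra hjI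
    exact hneg hqG (h2 ⟨j, hjI, rfl⟩) hj

end Columns

/-! ### Generic sets of natural numbers with prescribed first runs -/

section Runs

/-- `X` contains the run `x, x + 1, …, x + a`. -/
def IsRun {M : Type*} [Add M] [LE M] (X : Set M) (a x : M) : Prop :=
  ∀ i ≤ a, x + i ∈ X

/-- `x` is the starting point of the first run of length `a + 1` in `X`. -/
def IsFirstRun {M : Type*} [Add M] [LE M] (X : Set M) (a x : M) : Prop :=
  IsRun X a x ∧ ∀ y, IsRun X a y → x ≤ y

/-- If `P` and `Q` are separated by the gap `l`, a first run of `P ∪ Q` is one of `P`, unless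
only `Q` has runs of this length. -/
theorem IsFirstRun.of_union {P Q : Set ℕ} {l a x : ℕ} (hP : ∀ y ∈ P, y < l) (hQ : ∀ y ∈ Q, l < y)
    (hx : IsFirstRun (P ∪ Q) a x) (h : (∃ y, IsRun P a y) ∨ ∀ y, ¬ IsRun Q a y) :
    IsFirstRun P a x := by
  have hsub {y : ℕ} (hy : IsRun P a y) : x ≤ y := hx.2 y fun i hi => Or.inl (hy i hi)
  have hrun : IsRun P a x ∨ IsRun Q a x := by
    by_cases hxl : x ∈ P
    · left
      intro i
      induction i with
      | zero => exact fun _ => hxl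
      | succ i ih =>
        intro hi
        refine (hx.1 (i + 1) hi).resolve_right fun h1 => ?_
        have := hP _ (ih (by omega))
        have := hQ _ h1
        omega
    · right
      intro i hi
      have := hQ _ ((hx.1 0 (Nat.zero_le _)).resolve_left hxl)
      exact (hx.1 i hi).resolve_left fun h1 => by have := hP _ h1; omega
  refine ⟨hrun.resolve_right fun hq => ?_, fun y hy => hsub hy⟩
  rcases h with ⟨y, hy⟩ | h
  · have h1 := hsub hy
    have h2 := hP _ (hy 0 (Nat.zero_le _))
    have h3 := hQ _ (hq 0 (Nat.zero_le _))
    omega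
  · exact h x hq

/-- Conditions for the construction in the standard case: the part of `X` below `len`, such that
the first run of length `a + 1`, if there is one, starts at an even number just when `a ∈ A`. -/
structure RunCond (A : Set ℕ) where
  /-- The part of `X` below `len`. -/
  carrier : Set ℕ
  /-- The bound below which `X` is decided. -/
  len : ℕ
  len_pos : 0 < len
  lt_len : ∀ x ∈ carrier, x < len
  zero_notMem : 0 ∉ carrier
  even_iff : ∀ a x, IsFirstRun carrier a x → (Even x ↔ a ∈ A)

namespace RunCond

variable {A : Set ℕ} {κ : Type*}

/-- Conditions are ordered by end extension. -/
instance : Preorder (RunCond A) where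
  le p q := p.len ≤ q.len ∧ ∀ x < p.len, x ∈ p.carrier ↔ x ∈ q.carrier
  le_refl p := ⟨le_rfl, fun _ _ => Iff.rfl⟩
  le_trans p q r hpq hqr := ⟨hpq.1.trans hqr.1, fun x hx =>
    (hpq.2 x hx).trans (hqr.2 x (hx.trans_le hpq.1))⟩

/-- Adding new points `Q` beyond a gap extends a condition, provided that first runs contributed
by `Q` have the prescribed parity. -/
theorem exists_ge_union (p : RunCond A) {Q : Set ℕ} (hQ : ∀ y ∈ Q, p.len < y) {l : ℕ}
    (hl : p.len ≤ l) (hQl : ∀ y ∈ Q, y < l)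
    (h : ∀ a x, IsFirstRun (p.carrier ∪ Q) a x →
      ((∃ y, IsRun p.carrier a y) ∨ ∀ y, ¬ IsRun Q a y) ∨ (Even x ↔ a ∈ A)) :
    ∃ q ≥ p, q.carrier = p.carrier ∪ Q ∧ q.len = l := by
  refine ⟨⟨p.carrier ∪ Q, l, p.len_pos.trans_le hl, ?_, ?_, fun a x hx => ?_⟩, ⟨hl, fun x hx => ?_⟩,
    rfl, rfl⟩
  · rintro x (hx | hx)
    · exact (p.lt_len x hx).trans_le hl
    · exact hQl x hx
  · rintro (h0 | h0)
    · exact p.zero_notMem h0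
    · exact absurd (hQ 0 h0) (Nat.not_lt_zero _)
  · rcases h a x hx with h | h
    · exact p.even_iff a x (hx.of_union p.lt_len hQ h)
    · exact h
  · exact ⟨Or.inl, fun h => h.resolve_right fun h1 => (hQ x h1).not_gt hx⟩

/-- Every condition can be extended so as to contain a run of length `a + 1`. Runs are provided in
order of length, each separated from the previous part by a gap, so that every new run is a first
run for one length only and its starting point can be chosen of either parity. -/
theorem exists_ge_isRun (a : ℕ) (p : RunCond A) : ∃ q ≥ p, ∃ x, IsRun q.carrier a x := by
  induction a using Nat.strong_induction_on generalizing p with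
  | _ a ih =>
  obtain ⟨p', hp', hrun⟩ : ∃ q ≥ p, ∀ b < a, ∃ x, IsRun q.carrier b x := by
    rcases a with _ | a
    · exact ⟨p, le_rfl, by simp⟩
    · obtain ⟨q, hq, x, hx⟩ := ih a (Nat.lt_succ_self a) p
      exact ⟨q, hq, fun b hb => ⟨x, fun i hi => hx i (by omega)⟩⟩
  by_cases ha : ∃ x, IsRun p'.carrier a x
  · exact ⟨p', hp', ha⟩
  obtain ⟨x, hxl, hx⟩ : ∃ x, p'.len < x ∧ (Even x ↔ a ∈ A) := by
    rcases Nat.even_or_odd (p'.len + 1) with h | h <;> by_cases haA : a ∈ A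
    · exact ⟨_, Nat.lt_succ_self _, by simp [h, haA]⟩
    · exact ⟨p'.len + 1 + 1, by omega, by simp [Nat.even_add_one, h, haA]⟩
    · exact ⟨p'.len + 1 + 1, by omega, by simp only [haA, iff_true]; exact h.add_one⟩
    · exact ⟨_, Nat.lt_succ_self _, by simp only [haA, iff_false]; exact Nat.not_even_iff_odd.2 h⟩
  obtain ⟨q, hq, hqc, -⟩ := p'.exists_ge_union (Q := Set.Icc x (x + a)) (l := x + a + 1)
    (fun y hy => hxl.trans_le hy.1) (by omega) (fun y hy => Nat.lt_succ_of_le hy.2) (by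
      intro b y hy
      rcases lt_trichotomy b a with hb | rfl | hb
      · exact Or.inl (Or.inl (hrun b hb))
      · right
        have hyx : y ≤ x := hy.2 x fun i hi => Or.inr ⟨by omega, by omega⟩
        suffices y = x by rwa [this]
        by_contra hne
        refine ha ⟨y, fun i => ?_⟩
        induction i with
        | zero =>
          intro h0
          exact (hy.1 0 h0).resolve_right fun h1 => by have := h1.1; omega
        | succ i ih =>
          intro hi
          refine (hy.1 _ hi).resolve_right fun h1 => ?_
          have := p'.lt_len _ (ih (by omega))
          have := h1.1
          omega
      · refine Or.inl (Or.inr fun z hz => ?_)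
        have h1 := (hz 0 (Nat.zero_le _)).1
        have h2 := (hz b le_rfl).2
        omega)
  exact ⟨q, hp'.trans hq, x, fun i hi => hqc ▸ Or.inr ⟨by omega, by omega⟩⟩

/-- Every condition can be extended so as to realize a pattern on some tuple of `D`, if `D` has
tuples beyond any bound: a tuple of `n` new points creates no first run of length `n + 1` or more,
and shorter runs can be provided in advance. -/
theorem exists_ge_tuple {n : ℕ} {D : Set (Fin n → ℕ)} (I : Set (Fin n))
    (hD : ∀ N : ℕ, ∃ b ∈ D, b.Injective ∧ ∀ i, N < b i) (p : RunCond A) :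
    ∃ q ≥ p, ∃ b ∈ D, ∀ i, b i < q.len ∧ (b i ∈ q.carrier ↔ i ∈ I) := by
  obtain ⟨p', hp', x, hx⟩ := p.exists_ge_isRun n
  obtain ⟨b, hb, hinj, hlt⟩ := hD p'.len
  obtain ⟨l, hl⟩ := (Set.finite_range b).bddAbove
  have hl (i : Fin n) : b i ≤ l := hl ⟨i, rfl⟩
  obtain ⟨q, hq, hqc, hql⟩ := p'.exists_ge_union (Q := b '' I) (l := p'.len + l + 1)
    (by rintro _ ⟨i, -, rfl⟩; exact hlt i) (by omega)
    (by rintro _ ⟨i, -, rfl⟩; have := hl i; omega) (by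
      intro a y _
      left
      rcases le_total a n with han | han
      · exact Or.inl ⟨x, fun i hi => hx i (hi.trans han)⟩
      · right
        intro z hz
        choose f hf using fun i : Fin (a + 1) => hz i (Nat.lt_succ_iff.1 i.2)
        have hfi : f.Injective := fun i j hij => by
          have h1 := (hf i).2
          have h2 := (hf j).2
          rw [hij] at h1
          ext
          omega
        have := Fintype.card_le_of_injective f hfi
        simp at this
        omega)
  refine ⟨q, hp'.trans hq, b, hb, fun i => ⟨by have := hl i; omega, ?_⟩⟩
  rw [hqc]
  refine ⟨?_, fun hi => Or.inr ⟨i, hi, rfl⟩⟩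
  rintro (h | ⟨j, hj, hji⟩)
  · exact absurd (hlt i) (p'.lt_len _ h).not_gt
  · exact hinj hji ▸ hj

/-- There is a set `X` of natural numbers, not containing `0`, which realizes countably many
prescribed patterns, such that `a ∈ A` just when the first run of length `a + 1` in `X` starts at
an even number. -/
theorem exists_generic [Countable κ] (A : Set ℕ)
    {n : κ → ℕ} {D : ∀ k, Set (Fin (n k) → ℕ)} (I : ∀ k, Set (Fin (n k)))
    (hD : ∀ (k : κ) (N : ℕ), ∃ b ∈ D k, b.Injective ∧ ∀ i, N < b i) :
    ∃ X : Set ℕ, 0 ∉ X ∧ (∀ a, a ∈ A ↔ ∃ x, IsFirstRun X a x ∧ Even x) ∧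
      ∀ k, ∃ b ∈ D k, ∀ j, b j ∈ X ↔ j ∈ I k := by
  let p₀ : RunCond A := ⟨∅, 1, one_pos, by simp, by simp, fun a x hx =>
    (hx.1 0 (Nat.zero_le _)).elim⟩
  let 𝒟 : ℕ ⊕ κ → Order.Cofinal (RunCond A) := Sum.elim
    (fun a => ⟨{q | ∃ x, IsRun q.carrier a x}, fun p => by
      obtain ⟨q, hq, h⟩ := p.exists_ge_isRun a; exact ⟨q, h, hq⟩⟩)
    (fun k => ⟨{q | ∃ b ∈ D k, ∀ i, b i < q.len ∧ (b i ∈ q.carrier ↔ i ∈ I k)}, fun p => by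
      obtain ⟨q, hq, h⟩ := p.exists_ge_tuple (I k) (hD k); exact ⟨q, h, hq⟩⟩)
  let _ : Encodable (ℕ ⊕ κ) := Encodable.ofCountable _
  let G := Order.idealOfCofinals p₀ 𝒟
  let X : Set ℕ := {x | ∃ q ∈ G, x ∈ q.carrier}
  have hX {q : RunCond A} (hq : q ∈ G) {x : ℕ} (hx : x < q.len) : x ∈ X ↔ x ∈ q.carrier := by
    refine ⟨?_, fun h => ⟨q, hq, h⟩⟩
    rintro ⟨r, hr, hxr⟩
    obtain ⟨s, -, hqs, hrs⟩ := G.directed q hq r hr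
    exact (hqs.2 x hx).2 ((hrs.2 x (r.lt_len x hxr)).1 hxr)
  refine ⟨X, ?_, fun a => ?_, fun k => ?_⟩
  · rintro ⟨q, -, hq⟩
    exact q.zero_notMem hq
  · obtain ⟨q, hrun, hqG⟩ := Order.cofinal_meets_idealOfCofinals p₀ 𝒟 (Sum.inl a)
    have hrun : ∃ x, IsRun q.carrier a x := hrun
    classical
    have hfirst : IsFirstRun q.carrier a (Nat.find hrun) :=
      ⟨Nat.find_spec hrun, fun y hy => Nat.find_min' hrun hy⟩
    have hfirstX : IsFirstRun X a (Nat.find hrun) := by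
      refine ⟨fun i hi => ⟨q, hqG, hfirst.1 i hi⟩, fun y hy => ?_⟩
      by_contra hlt
      refine hlt (hfirst.2 y fun i hi => (hX hqG ?_).1 (hy i hi))
      have := q.lt_len _ (hfirst.1 a le_rfl)
      omega
    rw [← q.even_iff a _ hfirst]
    refine ⟨fun h => ⟨_, hfirstX, h⟩, ?_⟩
    rintro ⟨x, hx, hev⟩
    rwa [le_antisymm (hfirstX.2 x hx.1) (hx.2 _ hfirstX.1)]
  · obtain ⟨q, ⟨b, hb, h⟩, hqG⟩ := Order.cofinal_meets_idealOfCofinals p₀ 𝒟 (Sum.inr k)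
    exact ⟨b, hb, fun j => (hX hqG (h j).1).trans (h j).2⟩

end RunCond

end Runs

/-! ### The decoding formula -/

section Decoding

variable {α : Type}

/-- The term `1` of `L_PA ∪ {X}`. -/
def xOne : LPAX.Term α := Constants.term (L := LPAX) (Sum.inl PAFunc.one)

/-- The term `0` of `L_PA ∪ {X}`. -/
def xZero : LPAX.Term α := Constants.term (L := LPAX) (Sum.inl PAFunc.zero)

/-- The term `s + t` of `L_PA ∪ {X}`. -/
def xAdd (s t : LPAX.Term α) : LPAX.Term α := Functions.apply₂ (L := LPAX) (Sum.inl PAFunc.add) s t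

/-- The term `s · t` of `L_PA ∪ {X}`. -/
def xMul (s t : LPAX.Term α) : LPAX.Term α := Functions.apply₂ (L := LPAX) (Sum.inl PAFunc.mul) s t

/-- The formula `s ≤ t` of `L_PA ∪ {X}`. -/
def xLe {n : ℕ} (s t : LPAX.Term (α ⊕ Fin n)) : LPAX.BoundedFormula α n :=
  Relations.boundedFormula₂ (L := LPAX) (Sum.inl PARel.le) s t

/-- The formula `t ∈ X`. -/
def xMem {n : ℕ} (t : LPAX.Term (α ⊕ Fin n)) : LPAX.BoundedFormula α n :=
  Relations.boundedFormula₁ (L := LPAX) (Sum.inr PredRel.X) t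

/-- The formula `s * s ∈ X` for all `s ≤ t`, where `t` is the last variable. -/
def inCutFormula (n : ℕ) : LPAX.BoundedFormula (Fin 1) (n + 1) :=
  ∀' (xLe (Term.var (Sum.inr (Fin.last (n + 1)))) (Term.var (Sum.inr (Fin.last n).castSucc)) ⟹
    xMem (xMul (Term.var (Sum.inr (Fin.last (n + 1)))) (Term.var (Sum.inr (Fin.last (n + 1))))))

/-- The formula `IsRun X a t`, where `a` is the free variable and `t` is the last variable. -/
def isRunFormula (n : ℕ) : LPAX.BoundedFormula (Fin 1) (n + 1) :=
  ∀' (xLe (Term.var (Sum.inr (Fin.last (n + 1)))) (Term.var (Sum.inl 0)) ⟹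
    xMem (xAdd (Term.var (Sum.inr (Fin.last n).castSucc)) (Term.var (Sum.inr (Fin.last (n + 1))))))

/-- The formula which decodes `A` from `X`: if `0 ∈ X`, then `a ∈ A` means that `X` contains a
final segment of the standard part of column `a + 1`; if `0 ∉ X`, then `a ∈ A` means that the first
run of length `a + 1` in `X` starts at an even number. -/
def decodingFormula : LPAX.Formula (Fin 1) :=
  let a₁ : LPAX.Term (Fin 1 ⊕ Fin 2) := xAdd (Term.var (Sum.inl 0)) xOne
  (xMem xZero ⊓ ∃' (inCutFormula 0 ⊓ ∀' (inCutFormula 1 ⟹ xLe &0 &1 ⟹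
    xMem (xAdd (xMul (xAdd a₁ &1) (xAdd a₁ &1)) a₁)))) ⊔
  (∼(xMem xZero) ⊓ ∃' ((isRunFormula 0 ⊓ ∀' (isRunFormula 1 ⟹ xLe &0 &1)) ⊓
    ∃' (&0 =' xAdd &1 &1)))

/-- `X` contains `0, 1, 4, …, k * k`. -/
def InCut {M : Type*} [Mul M] [LE M] (X : Set M) (k : M) : Prop := ∀ i ≤ k, i * i ∈ X

/-- The `k`-th element of column `a`. -/
def column {M : Type*} [Add M] [Mul M] (a k : M) : M := (a + k) * (a + k) + a

theorem realize_xMem {M : Type*} [LPA.Structure M] (X : Set M) {v : α → M} {n : ℕ} {xs : Fin n → M}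
    {t : LPAX.Term (α ⊕ Fin n)} : letI := predStructure X
    (xMem t).Realize v xs ↔ t.realize (Sum.elim v xs) ∈ X :=
  Iff.rfl

variable {M : Type*} [LPA.Structure M] [Zero M] [One M] [Add M] [Mul M] [LE M] [Compatible M]

section Realize

variable [LX.Structure M] {v : α → M} {n : ℕ}

@[simp] theorem realize_xZero : (xZero : LPAX.Term α).realize v = 0 :=
  Compatible.funMap_zero _

@[simp] theorem realize_xOne : (xOne : LPAX.Term α).realize v = 1 :=
  Compatible.funMap_one _

@[simp] theorem realize_xAdd {s t : LPAX.Term α} :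
    (xAdd s t).realize v = s.realize v + t.realize v :=
  Compatible.funMap_add _

@[simp] theorem realize_xMul {s t : LPAX.Term α} :
    (xMul s t).realize v = s.realize v * t.realize v :=
  Compatible.funMap_mul _

@[simp] theorem realize_xLe {xs : Fin n → M} {s t : LPAX.Term (α ⊕ Fin n)} :
    (xLe s t).Realize v xs ↔ s.realize (Sum.elim v xs) ≤ t.realize (Sum.elim v xs) :=
  Compatible.relMap_le _

end Realize

theorem definesIn_decodingFormula (X A : Set M) : DefinesIn decodingFormula X A ↔
    A = {a | (0 ∈ X ∧ ∃ m, InCut X m ∧ ∀ k, InCut X k → m ≤ k → column (a + 1) k ∈ X) ∨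
      (0 ∉ X ∧ ∃ x, IsFirstRun X a x ∧ ∃ z, x = z + z)} := by
  rw [DefinesIn]
  refine iff_of_eq (congrArg (A = Set.ofPred ·) (funext fun a => propext ?_))
  let _ : LX.Structure M := predStructure X
  have h1 (n : ℕ) (xs : Fin n → M) (t : M) : (inCutFormula n).Realize (fun _ => a)
      (Fin.snoc xs t : Fin (n + 1) → M) ↔ InCut X t := by
    simp [inCutFormula, realize_xMem X, InCut]
  have h2 (n : ℕ) (xs : Fin n → M) (t : M) : (isRunFormula n).Realize (fun _ => a)
      (Fin.snoc xs t : Fin (n + 1) → M) ↔ IsRun X a t := by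
    simp [isRunFormula, realize_xMem X, IsRun]
  simp [decodingFormula, Formula.Realize, h1, h2, realize_xMem X, Fin.snoc, IsFirstRun, column]

end Decoding

/-! ### Large sets and the genericity requirements -/

section Generic

variable {M : Type*}

/-- `D ⊆ Mⁿ` has an infinite subset of pairwise disjoint tuples with distinct entries. -/
def IsLarge {n : ℕ} (D : Set (Fin n → M)) : Prop :=
  ∃ B ⊆ D, B.Infinite ∧ ∀ b ∈ B, ∀ c ∈ B, b ≠ c →
    (∀ i j, i ≠ j → b i ≠ b j) ∧ Disjoint (Set.range b) (Set.range c)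

/-- Disjoint tuples meet a finite set only finitely often. -/
theorem IsLarge.exists_avoiding {n : ℕ} {D : Set (Fin n → M)} (hD : IsLarge D) {F : Set M}
    (hF : F.Finite) : ∃ b ∈ D, b.Injective ∧ ∀ i, b i ∉ F := by
  obtain ⟨B, hBD, hB, h⟩ := hD
  suffices ∃ b ∈ B, ∀ i, b i ∉ F by
    obtain ⟨b, hb, hbF⟩ := this
    obtain ⟨c, hc, hcb⟩ := hB.nontrivial.exists_ne b
    exact ⟨b, hBD hb, fun i j hij => by_contra fun hne => (h b hb c hc hcb.symm).1 i j hne hij, hbF⟩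
  -- Otherwise every tuple of `B` has an entry in `F`, and this entry determines the tuple.
  by_contra! hcon
  have : Nonempty (Fin n) := hB.nonempty.elim fun b hb => ⟨(hcon b hb).choose⟩
  choose! f hf using hcon
  refine hB (Set.Finite.of_finite_image (f := fun b => b (f b)) (hF.subset ?_) ?_)
  · rintro _ ⟨b, hb, rfl⟩
    exact hf b hb
  · intro b hb c hc hbc
    by_contra hne
    exact Set.disjoint_left.1 (h b hb c hc hne).2 ⟨f b, rfl⟩ ⟨f c, hbc.symm⟩

variable (M) [LPA.Structure M]

/-- The genericity requirements: a large definable set and a pattern. -/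
abbrev Requirement : Type _ :=
  {q : Σ n, Set (Fin n → M) × Set (Fin n) //
    (Set.univ : Set M).Definable LPA q.2.1 ∧ IsLarge q.2.1}

instance : Countable LPA.Symbols := by
  have h1 : Countable (Σ n, LPA.Functions n) := by
    refine Function.Injective.countable (β := ℕ) (f := fun
      | ⟨_, PAFunc.zero⟩ => 0
      | ⟨_, PAFunc.one⟩ => 1
      | ⟨_, PAFunc.add⟩ => 2
      | ⟨_, PAFunc.mul⟩ => 3) ?_
    rintro ⟨_, _ | _⟩ ⟨_, _ | _⟩ <;> simp
  have h2 : Countable (Σ n, LPA.Relations n) := by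
    refine Function.Injective.countable (β := ℕ) (f := fun _ => 0) ?_
    rintro ⟨_, _ | _⟩ ⟨_, _ | _⟩
    simp
  exact inferInstanceAs (Countable ((Σ n, LPA.Functions n) ⊕ (Σ n, LPA.Relations n)))

instance [Countable M] : Countable (Requirement M) := by
  let f (p : Σ n, LPA[[(Set.univ : Set M)]].Formula (Fin n) × Set (Fin n)) :
      Σ n, Set (Fin n → M) × Set (Fin n) := ⟨p.1, Set.ofPred p.2.1.Realize, p.2.2⟩
  refine ((Set.countable_range f).mono ?_).to_subtype
  rintro ⟨n, D, I⟩ ⟨⟨φ, hφ⟩, -⟩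
  exact ⟨⟨n, φ, I⟩, by simp only [f, ← hφ]⟩

variable {M}

theorem stronglyCPGeneric_of_requirements {X : Set M}
    (h : ∀ q : Requirement M, ∃ b ∈ q.1.2.1, ∀ i, b i ∈ X ↔ i ∈ q.1.2.2) :
    StronglyCPGeneric X :=
  fun n D hD I hB => h ⟨⟨n, D, I⟩, hD, hB⟩

end Generic

/-! ### Coding an arbitrary subset of a model of `PA` -/

section Models

variable {M : Type*} [LPA.Structure M] [CommSemiring M] [LinearOrder M] [IsDiscreteModel M]

/-- In the standard model, runs are used for the coding. -/
theorem exists_stronglyCPGeneric_of_standard [Countable M] (hst : ∀ x : M, ∃ n : ℕ, (n : M) = x)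
    (A : Set M) : ∃ X : Set M, StronglyCPGeneric X ∧ DefinesIn decodingFormula X A := by
  obtain ⟨Y, h0, hA, hY⟩ := RunCond.exists_generic (κ := Requirement M)
    ((fun n : ℕ => (n : M)) ⁻¹' A) (D := fun q => (fun b i => ((b i : ℕ) : M)) ⁻¹' q.1.2.1)
    (fun q => q.1.2.2) (fun q N => by
      obtain ⟨b, hb, hinj, h⟩ := q.2.2.exists_avoiding
        ((Set.finite_Iic N).image (fun n : ℕ => (n : M)))
      choose c hc using fun i => hst (b i)
      obtain rfl : (fun i => (c i : M)) = b := funext hc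
      refine ⟨c, hb, fun i j hij => hinj (congrArg (fun n : ℕ => (n : M)) hij), fun i => ?_⟩
      by_contra hi
      exact h i ⟨c i, not_lt.1 hi, rfl⟩)
  have hmem (n : ℕ) : (n : M) ∈ (fun n : ℕ => (n : M)) '' Y ↔ n ∈ Y :=
    Function.Injective.mem_set_image Nat.cast_injective
  have hall {P : M → Prop} : (∀ x, P x) ↔ ∀ n : ℕ, P n :=
    ⟨fun h n => h n, fun h x => by obtain ⟨n, rfl⟩ := hst x; exact h n⟩
  have hex {P : M → Prop} : (∃ x, P x) ↔ ∃ n : ℕ, P n :=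
    ⟨fun ⟨x, h⟩ => by obtain ⟨n, rfl⟩ := hst x; exact ⟨n, h⟩, fun ⟨n, h⟩ => ⟨n, h⟩⟩
  refine ⟨(fun n : ℕ => (n : M)) '' Y, stronglyCPGeneric_of_requirements fun q => ?_, ?_⟩
  · obtain ⟨b, hb, h⟩ := hY q
    exact ⟨_, hb, fun i => (hmem _).trans (h i)⟩
  · rw [definesIn_decodingFormula]
    have h0' : (0 : M) ∉ (fun n : ℕ => (n : M)) '' Y := by
      rw [← Nat.cast_zero, hmem]; exact h0
    have hrun (a x : ℕ) : IsRun ((fun n : ℕ => (n : M)) '' Y) (a : M) x ↔ IsRun Y a x := by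
      simp only [IsRun, hall, Nat.cast_le, ← Nat.cast_add, hmem]
    ext x
    obtain ⟨a, rfl⟩ := hst x
    refine (hA a).trans ?_
    simp only [Set.mem_ofPred_eq, h0', false_and, false_or, not_false_eq_true, true_and, hex,
      IsFirstRun, hall, hrun, Nat.cast_le, ← Nat.cast_add, Nat.cast_inj, Even]

theorem exists_natCast_of_le {x : M} {n : ℕ} (hx : x ≤ n) :
    ∃ m : ℕ, (m : M) = x := by
  induction n generalizing x with
  | zero => exact ⟨0, (le_antisymm (by simpa using hx) (by simp)).symm⟩
  | succ n ih =>
    rcases IsDiscreteModel.eq_zero_or_one_le x with rfl | h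
    · exact ⟨0, Nat.cast_zero⟩
    · obtain ⟨y, rfl⟩ := exists_add_of_le h
      obtain ⟨m, rfl⟩ := ih (x := y) (by
        rw [Nat.cast_succ, add_comm] at hx
        exact le_of_add_le_add_right hx)
      exact ⟨m + 1, by rw [Nat.cast_succ, add_comm]⟩

/-- The quadratic pairing `(a, k) ↦ (a + k)² + a` is injective. -/
theorem column_inj {a b k l : M} (h : column a k = column b l) :
    a = b ∧ k = l := by
  -- The sum `a + k` is the integer part of the square root of `column a k`.
  have key {a b k l : M} (h : column a k = column b l) : ¬ a + k < b + l := by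
    intro hlt
    obtain ⟨d, hd⟩ := exists_add_of_le hlt.le
    obtain ⟨e, rfl⟩ := exists_add_of_le ((IsDiscreteModel.eq_zero_or_one_le d).resolve_left (by
      rintro rfl; simp [hd] at hlt))
    refine h.not_lt ?_
    calc column a k ≤ (a + k) * (a + k) + (a + k) := by
          exact add_le_add_right le_self_add _
      _ < (a + k) * (a + k) + (a + k) + 1 := lt_add_one _
      _ ≤ ((a + k) * (a + k) + (a + k) + 1) + ((a + k) + 2 * (a + k) * e + 2 * e + e * e + b) :=
          le_self_add
      _ = column b l := by rw [column, hd]; ring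
  have hs : a + k = b + l := le_antisymm (not_lt.1 (key h.symm)) (not_lt.1 (key h))
  have hab : a = b := by
    rw [column, column, hs] at h
    exact add_left_cancel h
  exact ⟨hab, by rw [hab] at hs; exact add_left_cancel hs⟩

/-- The elements of column `a` at standard places. -/
def standardColumn (a : M) : Set M := Set.range fun n : ℕ => column a n

/-- Initial segments of a column are uniformly definable. -/
theorem definable_bounded_column {α : Type*} [Finite α] {f g : (α → M) → M} (a : M)
    (hf : (Set.univ : Set M).DefinableFun LPA f) (hg : (Set.univ : Set M).DefinableFun LPA g) :
    (Set.univ : Set M).Definable LPA {v | ∃ k ≤ f v, g v = column a k} := by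
  have hS : (Set.univ : Set M).Definable LPA {w : Fin 2 → M | ∃ k ≤ w 0, w 1 = column a k} := by
    have h := (Set.Definable.inter
      (definable_le (M := M) (α := Fin 2 ⊕ Fin 1) (A := Set.univ) (f := fun w => w (Sum.inr 0))
        (g := fun w => w (Sum.inl 0)) (by fun_prop) (by fun_prop))
      (Set.DefinableFun.ofPred_eq (f := fun w => w (Sum.inl 1))
        (g := fun w => column a (w (Sum.inr 0))) (by fun_prop)
        (by unfold column; fun_prop))).exists_of_finite
    convert! h using 1
    ext w
    exact ⟨fun ⟨k, h⟩ => ⟨fun _ => k, h⟩, fun ⟨u, h⟩ => ⟨u 0, h⟩⟩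
  have hF : (Set.univ : Set M).DefinableMap LPA (fun v => ![f v, g v]) := by
    simp [Set.DefinableMap, *]
  exact hS.preimage_map hF

/-- The overspill principle: a definable set which contains the standard numbers of a nonstandard
model has a nonstandard element. -/
theorem overspill (hM : M ⊨ PA)
    (hns : ¬ ∀ x : M, ∃ n : ℕ, (n : M) = x) {T : Set M}
    (hT : (Set.univ : Set M).Definable₁ LPA T) (hst : ∀ n : ℕ, (n : M) ∈ T) :
    ∃ c ∈ T, ∀ n : ℕ, (n : M) ≤ c := by
  by_contra! hcon
  have hTst (x : M) (hx : x ∈ T) : ∃ n : ℕ, (n : M) = x := by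
    obtain ⟨n, hn⟩ := hcon x hx
    exact exists_natCast_of_le hn.le
  refine hns fun x => hTst x (definable_induction hM hT ?_ (fun x hx => ?_) x)
  · exact_mod_cast hst 0
  · obtain ⟨n, rfl⟩ := hTst x hx
    exact_mod_cast hst (n + 1)

/-- A large definable set has a tuple which avoids finitely many points and standard columns: if
its tuples had to meet the standard columns, overspill would bound the places where they do, and
finitely many points would meet all tuples. -/
theorem IsLarge.exists_avoiding_columns (hM : M ⊨ PA)
    (hns : ¬ ∀ x : M, ∃ n : ℕ, (n : M) = x) {n : ℕ} {D : Set (Fin n → M)} (hD : IsLarge D)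
    (hdef : (Set.univ : Set M).Definable LPA D) (S : Finset M) {F : Set M} (hF : F.Finite) :
    ∃ b ∈ D, b.Injective ∧ ∀ i, b i ∉ F ∧ ∀ s ∈ S, b i ∉ standardColumn s := by
  have := hF.to_subtype
  -- `c ∈ T` if some tuple of `D` avoids `F` and the places up to `c` of the columns in `S`.
  let T : Set M := {c | ∃ b ∈ D, (∀ p : {p : Fin n × Fin n // p.1 ≠ p.2}, b p.1.1 ≠ b p.1.2) ∧
    (∀ (i : Fin n) (z : F), b i ≠ z) ∧ ∀ (i : Fin n) (s : S), ¬ ∃ k ≤ c, b i = column s.1 k}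
  have hT : (Set.univ : Set M).Definable₁ LPA T := by
    have hR : (Set.univ : Set M).Definable LPA
        ({w : Fin 1 ⊕ Fin n → M | w ∘ Sum.inr ∈ D} ∩
        ((⋂ p : {p : Fin n × Fin n // p.1 ≠ p.2},
          {w : Fin 1 ⊕ Fin n → M | w (Sum.inr p.1.1) = w (Sum.inr p.1.2)}ᶜ) ∩
        ((⋂ i : Fin n, ⋂ z : F, {w : Fin 1 ⊕ Fin n → M | w (Sum.inr i) = z.1}ᶜ) ∩
        (⋂ i : Fin n, ⋂ s : S, {w : Fin 1 ⊕ Fin n → M |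
          ∃ k ≤ w (Sum.inl 0), w (Sum.inr i) = column s.1 k}ᶜ)))) := by
      refine (hdef.preimage_comp Sum.inr).inter (Set.Definable.inter ?_ (Set.Definable.inter ?_ ?_))
      · exact Set.definable_iInter_of_finite fun p =>
          (Set.DefinableFun.ofPred_eq (by fun_prop) (by fun_prop)).compl
      · exact Set.definable_iInter_of_finite fun i => Set.definable_iInter_of_finite fun z =>
          (Set.DefinableFun.ofPred_eq (by fun_prop) (by fun_prop)).compl
      · exact Set.definable_iInter_of_finite fun i => Set.definable_iInter_of_finite fun s =>
          (definable_bounded_column s.1 (by fun_prop) (by fun_prop)).compl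
    rw [Set.Definable₁]
    convert! hR.exists_of_finite using 1
    ext v
    simp only [T, Set.mem_ofPred_eq, Set.mem_inter_iff, Set.mem_iInter, Set.mem_compl_iff]
    exact Iff.rfl
  have hst (m : ℕ) : (m : M) ∈ T := by
    obtain ⟨b, hb, hinj, h⟩ := hD.exists_avoiding (F := F ∪ ⋃ s ∈ S,
      (fun k : ℕ => column s (k : M)) '' Set.Iic m)
      (hF.union (S.finite_toSet.biUnion fun s _ => (Set.finite_Iic m).image _))
    simp only [Set.mem_union, not_or, Set.mem_iUnion, not_exists] at h
    refine ⟨b, hb, fun p hp => p.2 (hinj hp), fun i z hz => (h i).1 (hz ▸ z.2), ?_⟩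
    rintro i s ⟨k, hk, hik⟩
    obtain ⟨k, rfl⟩ := exists_natCast_of_le hk
    exact (h i).2 s.1 s.2 ⟨k, Nat.cast_le.1 hk, hik.symm⟩
  obtain ⟨c, ⟨b, hb, hinj, hbF, hbS⟩, hc⟩ := overspill hM hns hT hst
  refine ⟨b, hb, fun i j hij => by_contra fun hne => hinj ⟨(i, j), hne⟩ hij, fun i =>
    ⟨fun h => hbF i ⟨_, h⟩ rfl, ?_⟩⟩
  rintro s hs ⟨k, hk⟩
  exact hbS i ⟨s, hs⟩ ⟨k, hc k, hk.symm⟩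

/-- If `X` is generic and contains the standard part of column `0`, it defines the standard
cut. -/
theorem StronglyCPGeneric.inCut_iff {X : Set M}
    (hX : StronglyCPGeneric X) (h0 : standardColumn 0 ⊆ X) {k : M} :
    InCut X k ↔ ∃ n : ℕ, (n : M) = k := by
  constructor
  · intro hk
    by_contra! hns
    have hlt (n : ℕ) : (n : M) ≤ k := by
      by_contra hn
      obtain ⟨m, hm⟩ := exists_natCast_of_le (not_le.1 hn).le
      exact hns m hm
    obtain ⟨b, ⟨i, hi, hbi⟩, hb⟩ := hX 1 {b | ∃ i ≤ k, b 0 = column 0 i}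
      (definable_bounded_column 0 (by fun_prop) (by fun_prop)) ∅
      ⟨Set.range fun (n : ℕ) (_ : Fin 1) => column 0 (n : M), by
        rintro _ ⟨n, rfl⟩
        exact ⟨n, hlt n, rfl⟩, Set.infinite_range_of_injective fun m n hmn =>
          Nat.cast_injective (column_inj (congrFun hmn 0)).2, by
        rintro _ ⟨m, rfl⟩ _ ⟨n, rfl⟩ hmn
        refine ⟨fun i j hij => absurd (Subsingleton.elim i j) hij, ?_⟩
        rw [Set.disjoint_left]
        rintro _ ⟨i, rfl⟩ ⟨j, hj⟩
        exact hmn (funext fun _ => hj.symm)⟩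
    refine ((hb 0).1 ?_).elim
    rw [hbi]
    simpa [column] using hk i hi
  · rintro ⟨n, rfl⟩ i hi
    obtain ⟨m, rfl⟩ := exists_natCast_of_le hi
    exact h0 ⟨m, by simp [column]⟩

/-- In a nonstandard model, columns are used for the coding. -/
theorem exists_stronglyCPGeneric_of_nonstandard [Countable M] (hM : M ⊨ PA)
    (hns : ¬ ∀ x : M, ∃ n : ℕ, (n : M) = x) (A : Set M) :
    ∃ X : Set M, StronglyCPGeneric X ∧ DefinesIn decodingFormula X A := by
  obtain ⟨X, h0, hin, hout, hX⟩ := exists_generic_of_columns (κ := Requirement M)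
    (E := standardColumn (M := M)) (A := insert 0 ((· + 1) '' A)) (i₀ := 0)
    (fun a b hab => by
      convert! Set.finite_empty (α := M)
      rw [← Set.disjoint_iff_inter_eq_empty, Set.disjoint_left]
      rintro _ ⟨k, rfl⟩ ⟨l, hl⟩
      exact hab (column_inj hl).1.symm)
    (Set.mem_insert _ _) (fun q => q.1.2.2)
    (fun q S F hF => q.2.2.exists_avoiding_columns hM hns q.2.1 S hF)
  have hgen := stronglyCPGeneric_of_requirements hX
  refine ⟨X, hgen, ?_⟩
  rw [definesIn_decodingFormula]
  have h0X : (0 : M) ∈ X := h0 ⟨0, by simp [column]⟩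
  have hinj (a : M) : Function.Injective fun n : ℕ => column a (n : M) := fun m n hmn =>
    Nat.cast_injective (column_inj hmn).2
  ext a
  simp only [Set.mem_ofPred_eq, h0X, true_and, not_true_eq_false, false_and, or_false,
    hgen.inCut_iff h0]
  constructor
  · intro ha
    obtain ⟨m, hm⟩ := ((hin (a + 1) (Or.inr ⟨a, ha, rfl⟩)).preimage (hinj (a + 1)).injOn).bddAbove
    refine ⟨_, ⟨m + 1, rfl⟩, ?_⟩
    rintro _ ⟨k, rfl⟩ hmk
    by_contra hk
    exact absurd (hm ⟨⟨k, rfl⟩, hk⟩) (not_le.2 (Nat.cast_le.1 hmk))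
  · rintro ⟨_, ⟨m, rfl⟩, hm⟩
    by_contra ha
    have hfin := (hout (a + 1) (by
      rintro (h | ⟨b, hb, hba⟩)
      · exact (add_pos_of_nonneg_of_pos (by simp) one_pos).ne' h
      · exact ha (add_right_cancel hba ▸ hb))).preimage (hinj (a + 1)).injOn
    exact Set.Ici_infinite m (hfin.subset fun k hk =>
      ⟨⟨k, rfl⟩, hm _ ⟨k, rfl⟩ (Nat.cast_le.2 hk)⟩)

end Models

end PAModels

theorem mainTheorem3 :
    ∃ φ : PAModels.LPAX.Formula (Fin 1),
      ∀ (M : Type*) [PAModels.LPA.Structure M] [Countable M], M ⊨ PAModels.PA →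
        ∀ A : Set M, ∃ X : Set M,
          PAModels.StronglyCPGeneric X ∧ PAModels.DefinesIn φ X A := by
  refine ⟨PAModels.decodingFormula, fun M _ _ hM A => ?_⟩
  obtain ⟨_, _, _⟩ := PAModels.exists_isDiscreteModel hM
  by_cases hst : ∀ x : M, ∃ n : ℕ, (n : M) = x
  · exact PAModels.exists_stronglyCPGeneric_of_standard hst A
  · exact PAModels.exists_stronglyCPGeneric_of_nonstandard hM hst A
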